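/- Let $\mathscr G=(S,B)$ be a countably infinite, connected, simple graph of bounded degree with path metric $d$, let $B_n(s)=\{t: d(s,t)\le n\}$, and let $\theta$ be its exponential growth rate, i.e. the infimum of all $\theta\ge 0$ for which there is a constant $c$ with $|B_n(s)|\le c\,e^{\theta n}$ for all $s\in S$ and $n\in\mathbb N_0$. Let $E$ be a nonempty finite set, $\Omega=E^S$, and for $\Lambda\subseteq S$ let $\mathscr F_\Lambda$ be the $\sigma$-algebra on $\Omega$ generated by the projections to the sites of $\Lambda$; put $\partial_k\Lambda=\{s\in\Lambda^c : d(s,\Lambda)\le k\}$. For $w\in E^\Lambda$ and $\omega\in\Omega$ let $w\,\omega_{\Lambda^c}$ be the configuration that equals $w$ on $\Lambda$ and $\omega$ off $\Lambda$. A specification $\rho=(\rho_\Lambda)_{\Lambda\subseteq S\text{ finite}}$ is a family of probability kernels $\rho_\Lambda$ from $\mathscr F_{\Lambda^c}$ to $\mathscr F_\Lambda$ that is consistent: for all finite $\Delta\subseteq\Lambda$, $\omega\in\Omega$ and $A\in\mathscr F_\Lambda$, $$\rho_\Lambda^\omega(A)=\sum_{w\in E^\Lambda}\rho_\Lambda^\omega(\{\zeta:\zeta_\Lambda=w\})\;\rho_\Delta^{w\omega_{\Lambda^c}}\big(\{\zeta:\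 \zeta_\Delta\,(w\omega_{\Lambda^c})_{\Delta^c}\in A\}\big).$$ It is $k$-Markovian if $\omega_{\partial_k\Lambda}=\tau_{\partial_k\Lambda}$ implies $\rho_\Lambda^\omega=\rho_\Lambda^\tau$ for all finite $\Lambda$ and all $\omega,\tau\in\Omega$. A probability measure $\mu$ on $\Omega$ is a Gibbs measure for $\rho$ (realizes $\rho$) if for all finite $\Lambda$ and all $A\in\mathscr F_\Lambda$ one has $\mu(A\mid\mathscr F_{\Lambda^c})(\omega)=\rho_\Lambda^\omega(A)$ for $\mu$-almost every $\omega$. The Dobrushin constant of $\rho$ is $\gamma=\sup_{s}\sum_{t}\gamma_{st}$, where $$\gamma_{st}=\sup\big\{\|\rho_{\{s\}}^\omega-\rho_{\{s\}}^\tau\|_{\mathrm{Var}}:\ \omega_{\{t\}^c}=\tau_{\{t\}^c}\big\},\qquad \|P-Q\|_{\mathrm{Var}}=\sup_A|P(A)-Q(A)|.$$ For $\lambda\in(0,\infty]$ and $U,V\subseteq S$ put $\Sigma(\lambda,U,V)=\sum_{t\in U}\sum_{s\in V}e^{-\lambda d(t,s)}$ (with $e^{-\infty\cdot 0}=1$ and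 $e^{-\infty\cdot n}=0$ for $n\ge1$) and $\varphi(U,V)=\sup\{|\mu(A\mid B)-\mu(A)|: A\in\mathscr F_U,\ B\in\mathscr F_V,\ \mu(B)>0\}$. The measure $\mu$ is $\varphi$-mixing with exponential decay rate $\lambda$ if there is a constant $C\ge1$ such that $\varphi(U,V)\le C\,\Sigma(\lambda,U,V)$ for all $U,V\subseteq S$ with $C\,\Sigma(\lambda,U,V)<1$. **Theorem.** Let $k\in\mathbb N_0$ and let $\rho$ be a $k$-Markovian specification with Dobrushin constant $\gamma<\exp(-3\theta k)$. Then there is exactly one Gibbs measure $\mu$ for $\rho$, and $\mu$ is $\varphi$-mixing with exponential decay rate $-\ln(\gamma)/k$, where this rate is read as $+\infty$ if $\gamma=0$ (in particular whenever $k=0$). -/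

import Mathlib

open MeasureTheory ProbabilityTheory
open scoped ENNReal

noncomputable section

namespace GibbsField

/-! Graphs -/

/-- There is a uniform bound on the degrees of all sites. -/
def BoundedDegree {S : Type*} (G : SimpleGraph S) : Prop :=
  ∃ D : ℕ, ∀ s : S, (G.neighborSet s).encard ≤ (D : ℕ∞)

/-- The ball `B_n(s)` of radius `n` around `s` for the path metric. -/
def ball {S : Type*} (G : SimpleGraph S) (s : S) (n : ℕ) : Set S :=
  {t | G.dist s t ≤ n}

/-- The exponential growth rate: the infimum of all `θ ≥ 0` such that the balls satisfy
`|B_n(s)| ≤ C * exp (θ n)`, uniformly in `s` and `n`, for some constant `C`. -/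
def growthRate {S : Type*} (G : SimpleGraph S) : ℝ :=
  sInf {θ : ℝ | 0 ≤ θ ∧ ∃ C : ℝ, ∀ (s : S) (n : ℕ),
    ((ball G s n).ncard : ℝ) ≤ C * Real.exp (θ * n)}

/-- The `k`-boundary `∂_k Λ`: the sites outside `Λ` at distance at most `k` from `Λ`. -/
def boundary {S : Type*} (G : SimpleGraph S) (k : ℕ) (Λ : Set S) : Set S :=
  {s | s ∉ Λ ∧ ∃ t ∈ Λ, G.dist s t ≤ k}

/-! Specifications.  A configuration is a map `S → E`, and `cylinderEvents Λ` is the σ-algebra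
`F_Λ` generated by the projections to the sites of `Λ`. -/

open Classical in
/-- The configuration `w_Λ ω_{Λᶜ}`, equal to `w` on `Λ` and to `ω` off `Λ`. -/
def glue {S E : Type*} (Λ : Finset S) (w : Λ → E) (ω : S → E) : S → E :=
  fun s => if h : s ∈ Λ then w ⟨s, h⟩ else ω s

open Classical in
/-- A specification: a family of probability kernels `ρ_Λ` from `F_{Λᶜ}` to `F_Λ`, for `Λ` finite,
that is consistent: for `Δ ⊆ Λ`, to sample from `ρ_Λ^ω` is the same as to sample `w` from `ρ_Λ^ω`
and then to resample the sites of `Δ` from `ρ_Δ` given `w_Λ ω_{Λᶜ}`. -/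
structure Specification (S E : Type*) [Fintype E] [MeasurableSpace E] where
  /-- the kernels -/
  kernel : ∀ Λ : Finset S,
    Kernel[cylinderEvents (X := fun _ : S => E) ((Λ : Set S)ᶜ),
      cylinderEvents (X := fun _ : S => E) (Λ : Set S)] (S → E) (S → E)
  isMarkovKernel : ∀ Λ : Finset S, IsMarkovKernel (kernel Λ)
  consistent : ∀ Δ Λ : Finset S, Δ ⊆ Λ → ∀ (ω : S → E) (A : Set (S → E)),
    MeasurableSet[cylinderEvents (X := fun _ : S => E) (Λ : Set S)] A →
      kernel Λ ω A = ∑ w : Λ → E, kernel Λ ω {ζ | Λ.restrict ζ = w} *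
        kernel Δ (glue Λ w ω) {ζ | glue Δ (Δ.restrict ζ) (glue Λ w ω) ∈ A}

/-- `ρ` is `k`-Markovian: `ρ_Λ^ω` depends on `ω` only through its restriction to `∂_k Λ`. -/
def Specification.IsMarkovian {S E : Type*} [Fintype E] [MeasurableSpace E]
    (ρ : Specification S E) (G : SimpleGraph S) (k : ℕ) : Prop :=
  ∀ (Λ : Finset S) (ω τ : S → E), (∀ s ∈ boundary G k (Λ : Set S), ω s = τ s) →
    ρ.kernel Λ ω = ρ.kernel Λ τ

/-- `μ` is a Gibbs measure for `ρ` (a realization of `ρ`): a probability measure such that for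
every finite `Λ` and `A ∈ F_Λ` the function `ω ↦ ρ_Λ^ω(A)` is a version of the conditional
probability of `A` given `F_{Λᶜ}`. -/
def Specification.IsGibbs {S E : Type*} [Fintype E] [MeasurableSpace E]
    (ρ : Specification S E) (μ : Measure (S → E)) : Prop :=
  IsProbabilityMeasure μ ∧
    ∀ (Λ : Finset S) (A : Set (S → E)),
      MeasurableSet[cylinderEvents (X := fun _ : S => E) (Λ : Set S)] A →
        μ[A.indicator (fun _ => (1 : ℝ)) |
            cylinderEvents (X := fun _ : S => E) ((Λ : Set S)ᶜ)]
          =ᵐ[μ] fun ω => (ρ.kernel Λ ω A).toReal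

/-- The total variation distance `sup_A |P(A) - Q(A)|` of two probability measures. -/
def tvDist {α : Type*} {m : MeasurableSpace α} (P Q : Measure α) : ℝ≥0∞ :=
  ⨆ (A : Set α) (_ : MeasurableSet[m] A), ENNReal.ofReal |(P A).toReal - (Q A).toReal|

/-- The entry `γ_{st}` of the dependency matrix. -/
def Specification.dependency {S E : Type*} [Fintype E] [MeasurableSpace E]
    (ρ : Specification S E) (s t : S) : ℝ≥0∞ :=
  ⨆ (ω : S → E) (τ : S → E) (_ : ∀ r, r ≠ t → ω r = τ r),
    tvDist (ρ.kernel {s} ω) (ρ.kernel {s} τ)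

/-- The Dobrushin constant `γ = sup_s ∑_t γ_{st}`. -/
def Specification.dobrushinConstant {S E : Type*} [Fintype E] [MeasurableSpace E]
    (ρ : Specification S E) : ℝ≥0∞ :=
  ⨆ s : S, ∑' t : S, ρ.dependency s t

/-! Mixing -/

/-- The coefficient `φ(U, V) = sup |μ(A | B) - μ(A)|` over `A ∈ F_U` and `B ∈ F_V` of positive
measure. -/
def phiCoeff {S E : Type*} [MeasurableSpace E] (μ : Measure (S → E)) (U V : Set S) : ℝ≥0∞ :=
  ⨆ (A : Set (S → E)) (B : Set (S → E))
    (_ : MeasurableSet[cylinderEvents (X := fun _ : S => E) U] A)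
    (_ : MeasurableSet[cylinderEvents (X := fun _ : S => E) V] B) (_ : 0 < μ B),
      ENNReal.ofReal |(cond μ B A).toReal - (μ A).toReal|

/-- `Σ(r, U, V) = ∑_{t ∈ U} ∑_{s ∈ V} exp (-r d(t, s))`, possibly infinite.  The rate `r` may be
`⊤`; then a term is `1` if `t = s` and `0` otherwise. -/
def expSum {S : Type*} (G : SimpleGraph S) (r : EReal) (U V : Set S) : ℝ≥0∞ :=
  ∑' (t : U) (s : V), EReal.exp (-(r * (G.dist (t : S) (s : S) : EReal)))

/-- `μ` is φ-mixing with exponential decay rate `r`. -/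
def IsPhiMixing {S E : Type*} [MeasurableSpace E] (G : SimpleGraph S) (μ : Measure (S → E))
    (r : EReal) : Prop :=
  ∃ C : ℝ, 1 ≤ C ∧ ∀ U V : Set S,
    ENNReal.ofReal C * expSum G r U V < 1 →
      phiCoeff μ U V ≤ ENNReal.ofReal C * expSum G r U V

/-- The rate `-ln(γ) / k`, read as `+∞` if `γ = 0` (which is always so if `k = 0` and `ρ` is
`k`-Markovian with Dobrushin constant `γ`). -/
def decayRate (k : ℕ) (γ : ℝ≥0∞) : EReal :=
  if γ = 0 then ⊤ else ((-Real.log γ.toReal / (k : ℝ) : ℝ) : EReal)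

end GibbsField

end

/-!
The proof is Dobrushin's comparison method. The growth rate is nonnegative, so `γ < 1`.

Call a function on `S → E` local if it depends on finitely many sites, and let `osc s f` be the
largest change of `f` under a change of the configuration at `s`. A vector `a` of weights is an
*estimate* for two probability measures `μ` and `ν` if `|μ(f) - ν(f)| ≤ ∑ s, a s * osc s f` for all
local `f`. The constant vector `1` is an estimate (`isEstimate_one`). If both measures are invariant
under resampling of the site `t` by the kernel `ρ_t`, then `f` may be replaced by `ρ_t f`, which
does not depend on the site `t` and satisfies `osc s (ρ_t f) ≤ osc s f + γ_{ts} * osc t f`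
(`osc_resample_le`). Hence the weight at `t` may be replaced by `∑ s, γ_{ts} * a s`
(`IsEstimate.update`), and, since a local function involves finitely many sites only, this may be
done at all such sites `t` simultaneously (`IsEstimate.improve`).

Suppose that `μ` and `ν` are invariant at all sites off `V`. Starting from `1`, after `n` rounds the
weights are at most `γ ^ n` plus the sum over `v ∈ V` and `j < n` of the entries of the `j`-th power
of the dependency matrix. Since `ρ` is `k`-Markovian, such an entry vanishes if `d(s, v) > j * k`,
and otherwise it is at most `γ ^ j`. Summing the geometric series gives the bound
`(1 - γ)⁻¹ * ∑ v ∈ V, exp (-λ d(s, v))` with `λ = -log γ / k` (`edist_integral_le`), and hence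
`|μ(A) - ν(A)| ≤ (1 - γ)⁻¹ * Σ(λ, U, V)` for `A ∈ F_U` (`edist_measureReal_le`). Two Gibbs measures
are invariant at all sites, so the case `V = ∅` is uniqueness. If `μ` is a Gibbs measure and
`B ∈ F_V`, then `μ(· | B)` is invariant at all sites off `V`, and this is mixing.

A Gibbs measure exists by compactness: the laws of configurations sampled in finite boxes with a
fixed boundary condition converge along an ultrafilter, and the identities that define a Gibbs
measure involve only integrals of local functions, because boundaries of finite sets are finite
(`exists_isGibbs`).
-/

namespace GibbsField

/-! ### Functions of finitely many sites -/

section Local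

variable {S E : Type*}

lemma exists_bound_of_dependsOn [Finite E] {F : Finset S} {f : (S → E) → ℝ}
    (hf : DependsOn f (F : Set S)) : ∃ M : ℝ, ∀ ω, ‖f ω‖ ≤ M := by
  obtain ⟨g, rfl⟩ := dependsOn_iff_exists_comp.mp hf
  obtain ⟨M, hM⟩ := (Set.finite_range fun w => ‖g w‖).bddAbove
  exact ⟨M, fun ω => hM ⟨_, rfl⟩⟩

/-- The algebra of events that are determined by finitely many sites of `U`. -/
def localEvents (E : Type*) (U : Set S) : Set (Set (S → E)) :=
  {A | ∃ F : Finset S, (F : Set S) ⊆ U ∧ DependsOn (· ∈ A) (F : Set S)}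

lemma isSetAlgebra_localEvents (U : Set S) : IsSetAlgebra (localEvents E U) where
  empty_mem := ⟨∅, by simp, fun _ _ _ => rfl⟩
  compl_mem := by
    rintro A ⟨F, hF, hA⟩
    refine ⟨F, hF, fun ω τ h => ?_⟩
    have := hA h
    simp only [Set.mem_compl_iff, this]
  union_mem := by
    classical
    rintro A B ⟨F, hF, hA⟩ ⟨F', hF', hB⟩
    refine ⟨F ∪ F', by simp [hF, hF'], fun ω τ h => ?_⟩
    have h1 := hA fun s hs => h s (by simp at hs ⊢; tauto)
    have h2 := hB fun s hs => h s (by simp at hs ⊢; tauto)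
    simp only at h1 h2
    simp only [Set.mem_union, h1, h2]

variable [MeasurableSpace E]

lemma measurableSet_cylinderEvents_of_dependsOn [Finite E] [MeasurableSingletonClass E]
    {F : Finset S} {A : Set (S → E)} (hA : DependsOn (· ∈ A) (F : Set S)) :
    MeasurableSet[cylinderEvents (X := fun _ : S => E) (F : Set S)] A := by
  have h : A = (F : Set S).domRestrict ⁻¹' ((F : Set S).domRestrict '' A) := by
    refine (Set.subset_preimage_image _ _).antisymm ?_
    rintro ω ⟨τ, hτ, h⟩
    exact (hA fun s hs => congrFun h ⟨s, hs⟩).mp hτ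
  rw [h]
  exact measurable_restrict_cylinderEvents (F : Set S) (Set.toFinite _).measurableSet

lemma measurable_cylinderEvents_of_dependsOn [Finite E] [MeasurableSingletonClass E]
    {β : Type*} [MeasurableSpace β] {F : Finset S} {f : (S → E) → β}
    (hf : DependsOn f (F : Set S)) :
    Measurable[cylinderEvents (X := fun _ : S => E) (F : Set S)] f := fun _ _ =>
  measurableSet_cylinderEvents_of_dependsOn fun _ _ h => by
    simp only [Set.mem_preimage, hf h]

lemma measurable_of_dependsOn [Finite E] [MeasurableSingletonClass E]
    {β : Type*} [MeasurableSpace β] {F : Finset S} {f : (S → E) → β}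
    (hf : DependsOn f (F : Set S)) : Measurable f :=
  (measurable_cylinderEvents_of_dependsOn hf).mono cylinderEvents_le_pi le_rfl

lemma dependsOn_of_measurableSet {U : Set S} {A : Set (S → E)}
    (hA : MeasurableSet[cylinderEvents (X := fun _ : S => E) U] A) : DependsOn (· ∈ A) U := by
  have hle : cylinderEvents (X := fun _ : S => E) U ≤
      MeasurableSpace.comap U.domRestrict MeasurableSpace.pi := by
    refine iSup₂_le fun s hs => ?_
    rintro _ ⟨B, hB, rfl⟩
    exact ⟨(fun σ : U → E => σ ⟨s, hs⟩) ⁻¹' B, measurable_pi_apply _ hB, rfl⟩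
  obtain ⟨B, -, rfl⟩ := hle _ hA
  intro ω τ h
  have : U.domRestrict ω = U.domRestrict τ := funext fun s => h s s.2
  simp only [Set.mem_preimage, this]

lemma integrable_of_dependsOn [Finite E] [MeasurableSingletonClass E] {F : Finset S}
    {f : (S → E) → ℝ} (hf : DependsOn f (F : Set S)) (μ : Measure (S → E)) [IsFiniteMeasure μ] :
    Integrable f μ := by
  obtain ⟨M, hM⟩ := exists_bound_of_dependsOn hf
  exact .of_bound (measurable_of_dependsOn hf).aestronglyMeasurable M (.of_forall hM)

lemma generateFrom_localEvents [Finite E] [MeasurableSingletonClass E] (U : Set S) :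
    cylinderEvents (X := fun _ : S => E) U = MeasurableSpace.generateFrom (localEvents E U) := by
  refine le_antisymm (iSup₂_le fun s hs => ?_) (MeasurableSpace.generateFrom_le ?_)
  · rintro _ ⟨B, -, rfl⟩
    refine MeasurableSpace.measurableSet_generateFrom ⟨{s}, by simpa, fun ω τ h => ?_⟩
    simp [h s (by simp)]
  · rintro A ⟨F, hF, hA⟩
    exact cylinderEvents_mono hF _ (measurableSet_cylinderEvents_of_dependsOn hA)

end Local

/-! ### Oscillations -/

section Oscillation

variable {S E : Type*}

/-- The oscillation of `f` at the site `s`: the largest change of `f` caused by a change of the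
configuration at `s` only. -/
noncomputable def osc (s : S) (f : (S → E) → ℝ) : ℝ≥0∞ :=
  ⨆ (ω : S → E) (τ : S → E) (_ : ∀ r, r ≠ s → ω r = τ r), edist (f ω) (f τ)

lemma edist_le_osc {s : S} (f : (S → E) → ℝ) {ω τ : S → E} (h : ∀ r, r ≠ s → ω r = τ r) :
    edist (f ω) (f τ) ≤ osc s f :=
  le_iSup_of_le ω <| le_iSup_of_le τ <| le_iSup_of_le h le_rfl

lemma osc_le {s : S} {f : (S → E) → ℝ} {c : ℝ≥0∞}
    (h : ∀ ω τ : S → E, (∀ r, r ≠ s → ω r = τ r) → edist (f ω) (f τ) ≤ c) : osc s f ≤ c :=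
  iSup_le fun ω => iSup_le fun τ => iSup_le fun hωτ => h ω τ hωτ

lemma osc_eq_zero {s : S} {f : (S → E) → ℝ} {U : Set S} (hf : DependsOn f U) (hs : s ∉ U) :
    osc s f = 0 := by
  refine le_antisymm (osc_le fun ω τ h => ?_) bot_le
  rw [hf fun r hr => h r (by rintro rfl; exact hs hr), edist_self]

lemma osc_ne_top [Finite E] {s : S} {F : Finset S} {f : (S → E) → ℝ}
    (hf : DependsOn f (F : Set S)) : osc s f ≠ ⊤ := by
  obtain ⟨M, hM⟩ := exists_bound_of_dependsOn hf
  refine ne_top_of_le_ne_top (b := ENNReal.ofReal (M + M)) ENNReal.ofReal_ne_top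
    (osc_le fun ω τ _ => ?_)
  rw [edist_dist]
  refine ENNReal.ofReal_le_ofReal ((dist_le_norm_add_norm _ _).trans ?_)
  gcongr <;> exact hM _

lemma edist_le_sum_osc {F : Finset S} {f : (S → E) → ℝ} (hf : DependsOn f (F : Set S))
    (ω τ : S → E) : edist (f ω) (f τ) ≤ ∑ s ∈ F, osc s f := by
  classical
  -- change the configuration from `τ` to `ω` one site at a time
  have key : ∀ F' : Finset S, edist (f (F'.piecewise ω τ)) (f τ) ≤ ∑ s ∈ F', osc s f := by
    intro F'
    induction F' using Finset.induction_on with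
    | empty => simp
    | insert s F' hs ih =>
      rw [Finset.sum_insert hs]
      refine (edist_triangle _ (f (F'.piecewise ω τ)) _).trans (add_le_add ?_ ih)
      refine edist_le_osc f fun r hr => ?_
      simp [Finset.piecewise, hr]
  have h := key F
  rwa [hf (y := ω) fun s hs => Finset.piecewise_eq_of_mem _ _ _ hs] at h

end Oscillation

/-! ### Resampling a single site -/

/-- A signed weight of total mass zero whose subsums are bounded by `c` integrates a function of
oscillation at most `D` to at most `c * D`. -/
lemma sum_sub_mul_le {ι : Type*} [Fintype ι] [Nonempty ι] {p q F : ι → ℝ} {c D : ℝ}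
    (hpq : ∑ i, p i = ∑ i, q i) (hc : ∀ A : Finset ι, ∑ i ∈ A, (p i - q i) ≤ c)
    (hD : ∀ i j, F i - F j ≤ D) : ∑ i, (p i - q i) * F i ≤ c * D := by
  classical
  obtain ⟨j, hj⟩ := Finite.exists_min F
  have hD0 : 0 ≤ D := by simpa using hD j j
  have h0 : ∑ i, (p i - q i) * F i = ∑ i, (p i - q i) * (F i - F j) := by
    simp_rw [mul_sub, Finset.sum_sub_distrib]
    rw [← Finset.sum_mul, Finset.sum_sub_distrib, hpq]
    ring
  calc ∑ i, (p i - q i) * F i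
      = ∑ i, (p i - q i) * (F i - F j) := h0
    _ ≤ ∑ i, if 0 ≤ p i - q i then (p i - q i) * D else 0 := by
        refine Finset.sum_le_sum fun i _ => ?_
        split_ifs with h
        · exact mul_le_mul_of_nonneg_left (hD i j) h
        · exact mul_nonpos_of_nonpos_of_nonneg (not_le.mp h).le (sub_nonneg.mpr (hj i))
    _ = (∑ i with 0 ≤ p i - q i, (p i - q i)) * D := by
        rw [← Finset.sum_filter, Finset.sum_mul]
    _ ≤ c * D := mul_le_mul_of_nonneg_right (hc _) hD0

section Resample

variable {S E : Type*} [Fintype E] [MeasurableSpace E]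

/-- The probability that the kernel of the site `t` puts the value `e` there. -/
noncomputable def Specification.siteProb (ρ : Specification S E) (t : S) (ω : S → E) (e : E) : ℝ :=
  (ρ.kernel {t} ω {ζ | ζ t = e}).toReal

open Classical in
/-- The function `ρ_t f` obtained from `f` by resampling the site `t`. -/
noncomputable def Specification.resample (ρ : Specification S E) (t : S) (f : (S → E) → ℝ)
    (ω : S → E) : ℝ :=
  ∑ e, ρ.siteProb t ω e * f (Function.update ω t e)

lemma tvDist_le_one {α : Type*} {m : MeasurableSpace α} (P Q : Measure α)
    [IsProbabilityMeasure P] [IsProbabilityMeasure Q] : tvDist P Q ≤ 1 := by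
  refine iSup₂_le fun A _ => ?_
  rw [← ENNReal.ofReal_one]
  refine ENNReal.ofReal_le_ofReal (abs_sub_le_iff.mpr ⟨?_, ?_⟩)
  · have h1 : P.real A ≤ 1 := measureReal_le_one
    have h2 : 0 ≤ Q.real A := measureReal_nonneg
    simp only [Measure.real] at h1 h2
    linarith
  · have h1 : Q.real A ≤ 1 := measureReal_le_one
    have h2 : 0 ≤ P.real A := measureReal_nonneg
    simp only [Measure.real] at h1 h2
    linarith

variable {ρ : Specification S E}

lemma dependency_le_one (ρ : Specification S E) (s t : S) : ρ.dependency s t ≤ 1 := by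
  refine iSup_le fun ω => iSup_le fun τ => iSup_le fun _ => ?_
  have := ρ.isMarkovKernel {s}
  exact tvDist_le_one _ _

section

variable [MeasurableSingletonClass E]

lemma measurableSet_siteEvent (t : S) (A : Set E) :
    MeasurableSet[cylinderEvents (X := fun _ : S => E) (({t} : Finset S) : Set S)]
      {ζ : S → E | ζ t ∈ A} :=
  measurableSet_cylinderEvents_of_dependsOn fun ω τ h => by simp [h t (by simp)]

lemma sum_siteProb (ρ : Specification S E) (t : S) (ω : S → E) (A : Finset E) :
    ∑ e ∈ A, ρ.siteProb t ω e = (ρ.kernel {t} ω {ζ | ζ t ∈ A}).toReal := by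
  have := ρ.isMarkovKernel {t}
  have h : {ζ : S → E | ζ t ∈ A} = ⋃ e ∈ A, {ζ | ζ t = e} := by ext; simp
  rw [h, measure_biUnion_finset, ENNReal.toReal_sum]
  · rfl
  · exact fun e _ => measure_ne_top _ _
  · intro e _ e' _ hee'
    refine Set.disjoint_left.mpr fun ζ h1 h2 => hee' ?_
    simp only [Set.mem_ofPred_eq] at h1 h2
    rw [← h1, h2]
  · exact fun e _ => measurableSet_siteEvent t {e}

lemma sum_siteProb_univ (ρ : Specification S E) (t : S) (ω : S → E) :
    ∑ e, ρ.siteProb t ω e = 1 := by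
  have := ρ.isMarkovKernel {t}
  rw [sum_siteProb]
  simp

lemma sum_siteProb_sub_le {s t : S} {ω τ : S → E} (h : ∀ r, r ≠ s → ω r = τ r) (A : Finset E) :
    ∑ e ∈ A, (ρ.siteProb t ω e - ρ.siteProb t τ e) ≤ (ρ.dependency t s).toReal := by
  rw [Finset.sum_sub_distrib, sum_siteProb, sum_siteProb]
  refine (le_abs_self _).trans ?_
  rw [← ENNReal.ofReal_le_iff_le_toReal ((dependency_le_one ρ t s).trans_lt ENNReal.one_lt_top).ne]
  refine le_trans ?_ (le_iSup_of_le ω <| le_iSup_of_le τ <| le_iSup_of_le h le_rfl)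
  exact le_iSup₂_of_le {ζ | ζ t ∈ A} (measurableSet_siteEvent t (A : Set E)) le_rfl

end

lemma siteProb_congr {G : SimpleGraph S} {k : ℕ} (hρ : ρ.IsMarkovian G k) {t : S} {ω τ : S → E}
    (h : ∀ s ∈ boundary G k {t}, ω s = τ s) : ρ.siteProb t ω = ρ.siteProb t τ := by
  funext e
  rw [Specification.siteProb, Specification.siteProb, hρ {t} ω τ (by simpa using h)]

lemma dependsOn_resample {G : SimpleGraph S} {k : ℕ} (hρ : ρ.IsMarkovian G k) {t : S}
    {U : Set S} {f : (S → E) → ℝ} (hf : DependsOn f U) :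
    DependsOn (ρ.resample t f) (U \ {t} ∪ boundary G k {t}) := by
  classical
  intro ω τ h
  rw [Specification.resample, Specification.resample,
    siteProb_congr hρ fun s hs => h s (Or.inr hs)]
  refine Finset.sum_congr rfl fun e _ => ?_
  congr 1
  convert hf (x := Function.update ω t e) (y := Function.update τ t e) fun s hs => ?_
  by_cases hst : s = t
  · simp [hst]
  · simp [hst, h s (Or.inl ⟨hs, hst⟩)]

lemma osc_resample_self {G : SimpleGraph S} {k : ℕ} (hρ : ρ.IsMarkovian G k) (t : S)
    (f : (S → E) → ℝ) : osc t (ρ.resample t f) = 0 :=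
  osc_eq_zero (dependsOn_resample hρ (dependsOn_univ f)) (by simp [boundary])

lemma osc_resample_le [MeasurableSingletonClass E] [Nonempty E] {s t : S}
    {F : Finset S} {f : (S → E) → ℝ} (hf : DependsOn f (F : Set S)) :
    osc s (ρ.resample t f) ≤ osc s f + ρ.dependency t s * osc t f := by
  classical
  have hc := ((dependency_le_one ρ t s).trans_lt ENNReal.one_lt_top).ne
  have hp : ∀ ω e, 0 ≤ ρ.siteProb t ω e := fun ω e => ENNReal.toReal_nonneg
  have key : ∀ ω τ : S → E, (∀ r, r ≠ s → ω r = τ r) →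
      ρ.resample t f ω - ρ.resample t f τ ≤
        (osc s f).toReal + (ρ.dependency t s).toReal * (osc t f).toReal := by
    intro ω τ h
    have hsplit : ρ.resample t f ω - ρ.resample t f τ =
        ∑ e, ρ.siteProb t ω e * (f (Function.update ω t e) - f (Function.update τ t e)) +
        ∑ e, (ρ.siteProb t ω e - ρ.siteProb t τ e) * f (Function.update τ t e) := by
      rw [Specification.resample, Specification.resample, ← Finset.sum_sub_distrib,
        ← Finset.sum_add_distrib]
      refine Finset.sum_congr rfl fun e _ => ?_
      ring
    have hosc : ∀ {r : S} {ξ η : S → E}, (∀ q, q ≠ r → ξ q = η q) →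
        f ξ - f η ≤ (osc r f).toReal := by
      intro r ξ η hr
      refine (le_abs_self _).trans ?_
      rw [← Real.dist_eq, ← ENNReal.ofReal_le_iff_le_toReal (osc_ne_top hf), ← edist_dist]
      exact edist_le_osc f hr
    rw [hsplit]
    refine add_le_add ?_ ?_
    · calc _ ≤ ∑ e, ρ.siteProb t ω e * (osc s f).toReal := by
            refine Finset.sum_le_sum fun e _ => mul_le_mul_of_nonneg_left (hosc fun q hq => ?_)
              (hp ω e)
            by_cases hqt : q = t
            · simp [hqt]
            · simp [hqt, h q hq]
        _ = (osc s f).toReal := by rw [← Finset.sum_mul, sum_siteProb_univ, one_mul]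
    · refine sum_sub_mul_le ?_ (sum_siteProb_sub_le h) fun e e' => hosc fun q hq => by simp [hq]
      rw [sum_siteProb_univ, sum_siteProb_univ]
  refine osc_le fun ω τ h => ?_
  have hfin : osc s f + ρ.dependency t s * osc t f ≠ ⊤ :=
    ENNReal.add_ne_top.mpr ⟨osc_ne_top hf, ENNReal.mul_ne_top hc (osc_ne_top hf)⟩
  rw [edist_dist, ENNReal.ofReal_le_iff_le_toReal hfin, ENNReal.toReal_add (osc_ne_top hf)
    (ENNReal.mul_ne_top hc (osc_ne_top hf)), ENNReal.toReal_mul, Real.dist_eq, abs_sub_le_iff]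
  exact ⟨key ω τ h, key τ ω fun r hr => (h r hr).symm⟩

end Resample

/-! ### Estimates and the comparison of two measures -/

section Comparison

variable {S E : Type*} [Fintype E] [MeasurableSpace E]

/-- `a` is an estimate for `μ` and `ν`: the integrals of a local function `f` differ by at most the
sum of the oscillations of `f` with weights `a`. -/
def IsEstimate (μ ν : Measure (S → E)) (a : S → ℝ≥0∞) : Prop :=
  ∀ (F : Finset S) (f : (S → E) → ℝ), DependsOn f (F : Set S) →
    edist (∫ ω, f ω ∂μ) (∫ ω, f ω ∂ν) ≤ ∑' s, a s * osc s f

/-- The measure `μ` is invariant under resampling of the site `t` by the kernel `ρ_t`. -/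
def Specification.IsInvariantAt (ρ : Specification S E) (t : S) (μ : Measure (S → E)) : Prop :=
  ∀ (F : Finset S) (f : (S → E) → ℝ), DependsOn f (F : Set S) →
    ∫ ω, ρ.resample t f ω ∂μ = ∫ ω, f ω ∂μ

omit [MeasurableSpace E] [Fintype E] in
lemma tsum_mul_osc {F : Finset S} {f : (S → E) → ℝ} (hf : DependsOn f (F : Set S))
    (a : S → ℝ≥0∞) : ∑' s, a s * osc s f = ∑ s ∈ F, a s * osc s f :=
  tsum_eq_sum fun s hs => by rw [osc_eq_zero hf (by simpa using hs), mul_zero]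

variable {μ ν : Measure (S → E)}

omit [Fintype E] in
lemma IsEstimate.mono {a a' : S → ℝ≥0∞} (ha : IsEstimate μ ν a) (h : ∀ s, a s ≤ a' s) :
    IsEstimate μ ν a' := fun F f hf =>
  (ha F f hf).trans (ENNReal.tsum_le_tsum fun s => by gcongr; exact h s)

omit [Fintype E] in
/-- A vector that coincides on every finite set with an estimate is an estimate, because local
functions have finitely many nonzero oscillations. -/
lemma isEstimate_of_finset {a : S → ℝ≥0∞}
    (h : ∀ F : Finset S, ∃ a', IsEstimate μ ν a' ∧ ∀ s ∈ F, a' s = a s) : IsEstimate μ ν a := by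
  intro F f hf
  obtain ⟨a', ha', heq⟩ := h F
  refine (ha' F f hf).trans_eq ?_
  rw [tsum_mul_osc hf, tsum_mul_osc hf]
  exact Finset.sum_congr rfl fun s hs => by rw [heq s hs]

lemma isEstimate_one [MeasurableSingletonClass E] [IsProbabilityMeasure μ]
    [IsProbabilityMeasure ν] : IsEstimate μ ν fun _ => 1 := by
  intro F f hf
  rw [tsum_mul_osc hf]
  simp_rw [one_mul]
  have hfin : ∑ s ∈ F, osc s f ≠ ⊤ := ENNReal.sum_ne_top.mpr fun s _ => osc_ne_top hf
  set D := (∑ s ∈ F, osc s f).toReal with hD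
  have hle : ∀ ω τ, f ω - f τ ≤ D := fun ω τ => by
    refine (le_abs_self _).trans ?_
    rw [← Real.dist_eq, ← ENNReal.ofReal_le_iff_le_toReal hfin, ← edist_dist]
    exact edist_le_sum_osc hf ω τ
  have key : ∀ (P Q : Measure (S → E)) [IsProbabilityMeasure P] [IsProbabilityMeasure Q],
      ∫ ω, f ω ∂P - ∫ ω, f ω ∂Q ≤ D := by
    intro P Q _ _
    have h1 : ∀ τ, ∫ ω, f ω ∂P - D ≤ f τ := fun τ => by
      have := integral_mono (μ := P) (integrable_of_dependsOn hf P)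
        (integrable_const (D + f τ)) fun ω => by linarith [hle ω τ]
      simp only [integral_const, probReal_univ, one_smul] at this
      linarith
    have := integral_mono (μ := Q) (integrable_const (∫ ω, f ω ∂P - D))
      (integrable_of_dependsOn hf Q) h1
    simp only [integral_const, probReal_univ, one_smul] at this
    linarith
  rw [edist_dist, ENNReal.ofReal_le_iff_le_toReal hfin, Real.dist_eq, abs_sub_le_iff]
  exact ⟨key μ ν, key ν μ⟩

variable {ρ : Specification S E} {G : SimpleGraph S} {k : ℕ}

open Classical in
/-- Resampling one site: where both measures are invariant under resampling, the weight of an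
estimate may be replaced by the mean of the weights with respect to the row of the dependency matrix. -/
lemma IsEstimate.update [MeasurableSingletonClass E] [Nonempty E] (hρ : ρ.IsMarkovian G k)
    {a : S → ℝ≥0∞} (ha : IsEstimate μ ν a) {t : S} (hfin : (boundary G k {t}).Finite)
    (hμ : ρ.IsInvariantAt t μ) (hν : ρ.IsInvariantAt t ν) :
    IsEstimate μ ν (Function.update a t (∑' s, ρ.dependency t s * a s)) := by
  intro F f hf
  rw [← hμ F f hf, ← hν F f hf]
  have hloc : DependsOn (ρ.resample t f) ((F ∪ hfin.toFinset : Finset S) : Set S) := by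
    refine (dependsOn_resample hρ hf).mono ?_
    rw [Finset.coe_union, Set.Finite.coe_toFinset]
    exact Set.union_subset_union_left _ Set.sdiff_subset
  refine (ha _ _ hloc).trans ?_
  set b : S → ℝ≥0∞ := Function.update a t 0
  set c := ∑' s, ρ.dependency t s * a s with hc
  calc ∑' s, a s * osc s (ρ.resample t f)
      ≤ ∑' s, (b s * osc s f + ρ.dependency t s * a s * osc t f) := by
        refine ENNReal.tsum_le_tsum fun s => ?_
        by_cases hst : s = t
        · rw [hst, osc_resample_self hρ]
          simp
        · have : b s = a s := Function.update_of_ne hst _ _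
          rw [this]
          calc a s * osc s (ρ.resample t f)
              ≤ a s * (osc s f + ρ.dependency t s * osc t f) := by
                gcongr
                exact osc_resample_le hf
            _ = _ := by ring
    _ = ∑' s, b s * osc s f + c * osc t f := by
        rw [ENNReal.tsum_add, ENNReal.tsum_mul_right]
    _ = ∑' s, (b s * osc s f + if s = t then c * osc t f else 0) := by
        rw [ENNReal.tsum_add, tsum_ite_eq]
    _ = ∑' s, Function.update a t c s * osc s f := by
        refine tsum_congr fun s => ?_
        by_cases hst : s = t
        · subst hst; simp [b]
        · simp [b, hst]

/-- Resampling all sites: the weights of an estimate may be lowered simultaneously to their means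
with respect to the dependency matrix at all sites where both measures are invariant. -/
lemma IsEstimate.improve [MeasurableSingletonClass E] [Nonempty E] (hρ : ρ.IsMarkovian G k)
    (hfin : ∀ t, (boundary G k {t}).Finite) {a a' : S → ℝ≥0∞} (ha : IsEstimate μ ν a)
    (h : ∀ t, a t ≤ a' t ∨ (ρ.IsInvariantAt t μ ∧ ρ.IsInvariantAt t ν ∧
      ∑' s, ρ.dependency t s * a s ≤ a' t)) : IsEstimate μ ν a' := by
  classical
  suffices H : IsEstimate μ ν fun s => min (a s) (a' s) from H.mono fun s => min_le_right _ _
  refine isEstimate_of_finset fun F => ⟨F.piecewise (fun s => min (a s) (a' s)) a, ?_,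
    fun s hs => Finset.piecewise_eq_of_mem _ _ _ hs⟩
  induction F using Finset.induction_on with
  | empty => simpa
  | insert t F ht ih =>
    rw [Finset.piecewise_insert]
    -- the weights only decrease, so the bound at `t` for `a` is also one for the present weights
    have hle : ∀ s, F.piecewise (fun s => min (a s) (a' s)) a s ≤ a s := fun s => by
      by_cases hs : s ∈ F <;> simp [hs]
    rcases le_or_gt (a t) (a' t) with hat | hat
    · refine ih.mono fun s => ?_
      by_cases hst : s = t
      · subst hst; simp [ht, hat]
      · simp [hst]
    · obtain ⟨hμ, hν, hsum⟩ := (h t).resolve_left hat.not_ge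
      refine (ih.update hρ (hfin t) hμ hν).mono fun s => ?_
      by_cases hst : s = t
      · subst hst
        simp only [Function.update_self]
        refine le_min ?_ ?_ <;> refine le_trans ?_ (hsum.trans ?_) <;>
          first
          | exact ENNReal.tsum_le_tsum fun r => by gcongr; exact hle r
          | exact hat.le
          | exact le_rfl
      · simp [hst]

end Comparison

/-! ### Finiteness of boundaries and the range of the dependency matrix -/

section Graph

variable {S : Type*} {G : SimpleGraph S} {k : ℕ}

lemma finite_ball (hconn : G.Connected) (hdeg : BoundedDegree G) (s : S) (n : ℕ) :
    (ball G s n).Finite := by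
  obtain ⟨D, hD⟩ := hdeg
  have hnb : ∀ t, (G.neighborSet t).Finite := fun t =>
    Set.encard_lt_top_iff.mp ((hD t).trans_lt (ENat.natCast_lt_top D))
  induction n with
  | zero =>
    refine (Set.finite_singleton s).subset fun t ht => ?_
    simp only [ball, Set.mem_ofPred_eq, nonpos_iff_eq_zero, hconn.dist_eq_zero_iff] at ht
    simp [ht]
  | succ n ih =>
    refine (ih.union (ih.biUnion fun t _ => hnb t)).subset fun t ht => ?_
    obtain ⟨p, hp⟩ := hconn.exists_walk_length_eq_dist t s
    cases p with
    | nil => exact Or.inl (by simp [ball])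
    | cons hadj p =>
      rename_i u
      refine Or.inr (Set.mem_biUnion (x := u) ?_ hadj.symm)
      simp only [ball, Set.mem_ofPred_eq, SimpleGraph.Walk.length_cons] at ht hp ⊢
      have := SimpleGraph.dist_le p
      rw [SimpleGraph.dist_comm] at ht ⊢
      omega

lemma finite_boundary (hconn : G.Connected) (hdeg : BoundedDegree G) (Λ : Finset S) :
    (boundary G k (Λ : Set S)).Finite := by
  refine (Λ.finite_toSet.biUnion fun t _ => finite_ball hconn hdeg t k).subset ?_
  rintro s ⟨-, t, ht, hst⟩
  exact Set.mem_biUnion ht (by rwa [ball, Set.mem_ofPred_eq, SimpleGraph.dist_comm])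

end Graph

section Iteration

variable {S E : Type*} [Fintype E] [MeasurableSpace E] {ρ : Specification S E}
  {G : SimpleGraph S} {k : ℕ}

lemma dependency_eq_zero (hρ : ρ.IsMarkovian G k) {s t : S} (h : t ∉ boundary G k {s}) :
    ρ.dependency s t = 0 := by
  refine le_antisymm (iSup_le fun ω => iSup_le fun τ => iSup_le fun hωτ => ?_) bot_le
  have : ρ.kernel {s} ω = ρ.kernel {s} τ := hρ {s} ω τ fun r hr => hωτ r (by
    rintro rfl
    exact h (by simpa using hr))
  rw [this]
  simp [tvDist]

lemma tsum_dependency_le (ρ : Specification S E) (s : S) :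
    ∑' t, ρ.dependency s t ≤ ρ.dobrushinConstant :=
  le_iSup (fun s => ∑' t, ρ.dependency s t) s

/-- An upper bound for the `(s, v)` entry of the `j`-th power of the dependency matrix, which
vanishes beyond distance `j * k`. -/
noncomputable def Specification.powerBound (ρ : Specification S E) (G : SimpleGraph S) (k j : ℕ)
    (s v : S) : ℝ≥0∞ :=
  if G.dist s v ≤ j * k then ρ.dobrushinConstant ^ j else 0

lemma powerBound_self (ρ : Specification S E) (G : SimpleGraph S) (k j : ℕ) (s : S) :
    ρ.powerBound G k j s s = ρ.dobrushinConstant ^ j := by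
  simp [Specification.powerBound]

lemma tsum_dependency_mul_powerBound_le (hconn : G.Connected) (hρ : ρ.IsMarkovian G k) (j : ℕ)
    (s v : S) :
    ∑' t, ρ.dependency s t * ρ.powerBound G k j t v ≤ ρ.powerBound G k (j + 1) s v := by
  by_cases h : G.dist s v ≤ (j + 1) * k
  · calc ∑' t, ρ.dependency s t * ρ.powerBound G k j t v
        ≤ ∑' t, ρ.dependency s t * ρ.dobrushinConstant ^ j := by
          refine ENNReal.tsum_le_tsum fun t => ?_
          gcongr
          rw [Specification.powerBound]
          split_ifs <;> simp
      _ ≤ ρ.dobrushinConstant * ρ.dobrushinConstant ^ j := by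
          rw [ENNReal.tsum_mul_right]
          gcongr
          exact tsum_dependency_le ρ s
      _ = ρ.powerBound G k (j + 1) s v := by
          rw [Specification.powerBound, if_pos h, pow_succ']
  · refine (ENNReal.tsum_eq_zero.mpr fun t => ?_).le.trans bot_le
    by_cases ht : t ∈ boundary G k {s}
    · obtain ⟨-, s', hs', hts⟩ := ht
      obtain rfl : s' = s := hs'
      have h1 := hconn.dist_triangle (u := s') (v := t) (w := v)
      rw [SimpleGraph.dist_comm] at hts
      have : ¬ G.dist t v ≤ j * k := fun h2 => h (by rw [add_mul]; omega)
      rw [Specification.powerBound, if_neg this, mul_zero]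
    · rw [dependency_eq_zero hρ ht, zero_mul]

variable {μ ν : Measure (S → E)}

/-- The `n`-th iterate of `IsEstimate.improve`, started from the constant estimate `1`, for two
measures that are both invariant under resampling of the sites off `V`. -/
lemma isEstimate_iterate [MeasurableSingletonClass E] [Nonempty E] [IsProbabilityMeasure μ]
    [IsProbabilityMeasure ν] (hconn : G.Connected) (hdeg : BoundedDegree G)
    (hρ : ρ.IsMarkovian G k) {V : Set S} (hμ : ∀ t ∉ V, ρ.IsInvariantAt t μ)
    (hν : ∀ t ∉ V, ρ.IsInvariantAt t ν) (n : ℕ) :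
    IsEstimate μ ν fun s => ρ.dobrushinConstant ^ n +
      ∑ j ∈ Finset.range n, ∑' v : V, ρ.powerBound G k j s v := by
  induction n with
  | zero => simpa using isEstimate_one
  | succ n ih =>
    refine ih.improve hρ (fun t => by simpa using finite_boundary hconn hdeg {t}) fun t => ?_
    by_cases ht : t ∈ V
    · left
      rw [Finset.sum_range_succ, add_comm]
      refine (add_le_add le_rfl ?_).trans le_add_self
      rw [← powerBound_self ρ G k n t]
      exact ENNReal.le_tsum (f := fun v : V => ρ.powerBound G k n t v) ⟨t, ht⟩
    · refine Or.inr ⟨hμ t ht, hν t ht, ?_⟩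
      simp_rw [mul_add, ENNReal.tsum_add, ENNReal.tsum_mul_right, Finset.mul_sum]
      rw [pow_succ', Summable.tsum_finsetSum fun _ _ => ENNReal.summable, Finset.sum_range_succ']
      gcongr
      · exact tsum_dependency_le ρ t
      · refine le_trans (Finset.sum_le_sum fun j _ => ?_) le_self_add
        simp_rw [← ENNReal.tsum_mul_left]
        rw [ENNReal.tsum_comm]
        exact ENNReal.tsum_le_tsum fun v => tsum_dependency_mul_powerBound_le hconn hρ j t v

/-- The sum over all `j` is a geometric series that starts at the first `j` with
`dist s v ≤ j * k`, whence the exponential decay at the rate `-log γ / k`. -/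
lemma sum_powerBound_le (ρ : Specification S E) (G : SimpleGraph S) (k n : ℕ)
    (hγ : ρ.dobrushinConstant < 1) (s v : S) :
    ∑ j ∈ Finset.range n, ρ.powerBound G k j s v ≤ (1 - ρ.dobrushinConstant)⁻¹ *
      EReal.exp (-(decayRate k ρ.dobrushinConstant * (G.dist s v : EReal))) := by
  set γ := ρ.dobrushinConstant with hγdef
  set d := G.dist s v with hd
  obtain ⟨m, hm, hle⟩ : ∃ m : ℕ, (∀ j < m, j * k < d) ∧
      γ ^ m ≤ EReal.exp (-(decayRate k γ * (d : EReal))) := by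
    -- the choice is `m = ⌈d / k⌉`, except that for `γ = 0`, where the rate is `⊤`, already `m = 1`
    -- suffices if `0 < d`
    by_cases h0 : γ = 0
    · refine ⟨min d 1, fun j hj => ?_, ?_⟩
      · obtain rfl : j = 0 := by omega
        omega
      · rcases Nat.eq_zero_or_pos d with hd0 | hd0
        · simp [hd0]
        · rw [min_eq_right hd0, h0]
          simp
    · -- for `k = 0` the rate and `d / k` both have the value `0`, so `m = 0` is consistent
      have hg0 : 0 < γ.toReal := ENNReal.toReal_pos h0 hγ.ne_top
      have hlog : Real.log γ.toReal < 0 :=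
        Real.log_neg hg0
          (by simpa using (ENNReal.toReal_lt_toReal hγ.ne_top ENNReal.one_ne_top).mpr hγ)
      refine ⟨⌈(d : ℝ) / k⌉₊, fun j hj => ?_, ?_⟩
      · have hj' := Nat.lt_ceil.mp hj
        have hk : (0 : ℝ) < k := by
          rcases Nat.eq_zero_or_pos k with hk | hk
          · subst hk
            simp only [CharP.cast_eq_zero, div_zero] at hj'
            exact absurd hj' (not_lt.mpr (Nat.cast_nonneg j))
          · exact_mod_cast hk
        rw [lt_div_iff₀ hk] at hj'
        exact_mod_cast hj'
      · rw [decayRate, if_neg h0]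
        have : (-(((-Real.log γ.toReal / (k : ℝ) : ℝ) : EReal) * (d : EReal))) =
            ((Real.log γ.toReal * (d / k) : ℝ) : EReal) := by
          rw [show (d : EReal) = ((d : ℝ) : EReal) by simp, ← EReal.coe_mul, ← EReal.coe_neg]
          congr 1
          ring
        rw [this, EReal.exp_coe, ← ENNReal.ofReal_toReal hγ.ne_top,
          ← ENNReal.ofReal_pow ENNReal.toReal_nonneg, ENNReal.toReal_ofReal ENNReal.toReal_nonneg]
        refine ENNReal.ofReal_le_ofReal ?_
        rw [← Real.rpow_natCast, Real.rpow_def_of_pos hg0]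
        exact Real.exp_le_exp.mpr (mul_le_mul_of_nonpos_left (Nat.le_ceil _) hlog.le)
  calc ∑ j ∈ Finset.range n, ρ.powerBound G k j s v
      ≤ ∑' j, ρ.powerBound G k j s v := ENNReal.sum_le_tsum _
    _ = ∑' i, ρ.powerBound G k (i + m) s v := by
        rw [← ENNReal.summable.sum_add_tsum_nat_add' (k := m), Finset.sum_eq_zero, zero_add]
        intro j hj
        rw [Specification.powerBound, if_neg (not_le.mpr (hm j (Finset.mem_range.mp hj)))]
    _ ≤ ∑' i, γ ^ i * γ ^ m := by
        refine ENNReal.tsum_le_tsum fun i => ?_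
        rw [Specification.powerBound, ← pow_add]
        split_ifs <;> simp [hγdef]
    _ = (1 - γ)⁻¹ * γ ^ m := by rw [ENNReal.tsum_mul_right, ENNReal.tsum_geometric]
    _ ≤ _ := by gcongr

/-- Dobrushin's comparison: two measures that are invariant under resampling of the sites off `V`
differ on local functions by a sum that decays exponentially with the distance to `V`. -/
lemma edist_integral_le [MeasurableSingletonClass E] [Nonempty E] [IsProbabilityMeasure μ]
    [IsProbabilityMeasure ν] (hconn : G.Connected) (hdeg : BoundedDegree G)
    (hρ : ρ.IsMarkovian G k) (hγ : ρ.dobrushinConstant < 1) {V : Set S}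
    (hμ : ∀ t ∉ V, ρ.IsInvariantAt t μ) (hν : ∀ t ∉ V, ρ.IsInvariantAt t ν)
    {F : Finset S} {f : (S → E) → ℝ} (hf : DependsOn f (F : Set S)) :
    edist (∫ ω, f ω ∂μ) (∫ ω, f ω ∂ν) ≤ ∑ s ∈ F, ((1 - ρ.dobrushinConstant)⁻¹ *
      ∑' v : V, EReal.exp (-(decayRate k ρ.dobrushinConstant * (G.dist s v : EReal)))) *
        osc s f := by
  set γ := ρ.dobrushinConstant with hγdef
  set c : S → ℝ≥0∞ := fun s => (1 - γ)⁻¹ *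
    ∑' v : V, EReal.exp (-(decayRate k γ * (G.dist s v : EReal))) with hc
  have hn : ∀ n : ℕ, edist (∫ ω, f ω ∂μ) (∫ ω, f ω ∂ν) ≤
      γ ^ n * ∑ s ∈ F, osc s f + ∑ s ∈ F, c s * osc s f := by
    intro n
    refine (isEstimate_iterate hconn hdeg hρ hμ hν n F f hf).trans ?_
    rw [tsum_mul_osc hf, Finset.mul_sum, ← Finset.sum_add_distrib]
    refine Finset.sum_le_sum fun s _ => ?_
    rw [← add_mul]
    gcongr
    rw [← Summable.tsum_finsetSum fun _ _ => ENNReal.summable, hc]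
    simp only
    rw [← ENNReal.tsum_mul_left]
    exact ENNReal.tsum_le_tsum fun v => sum_powerBound_le ρ G k n hγ s v
  have hfin : ∑ s ∈ F, osc s f ≠ ⊤ := ENNReal.sum_ne_top.mpr fun s _ => osc_ne_top hf
  have hlim : Filter.Tendsto (fun n : ℕ => γ ^ n * ∑ s ∈ F, osc s f + ∑ s ∈ F, c s * osc s f)
      Filter.atTop (nhds (0 * ∑ s ∈ F, osc s f + ∑ s ∈ F, c s * osc s f)) :=
    (ENNReal.Tendsto.mul_const (ENNReal.tendsto_pow_atTop_nhds_zero_of_lt_one hγ)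
      (Or.inr hfin)).add_const _
  rw [zero_mul, zero_add] at hlim
  exact ge_of_tendsto' hlim hn

end Iteration

/-! ### Uniqueness and mixing of Gibbs measures -/

section Gibbs

variable {S E : Type*} [Fintype E] [MeasurableSpace E] [MeasurableSingletonClass E]
  {ρ : Specification S E} {G : SimpleGraph S} {k : ℕ} {μ ν : Measure (S → E)}

/-- Resampling a site `t` does not change integrals over events that do not involve `t`. -/
lemma setIntegral_resample (hμ : ρ.IsGibbs μ) {t : S} {B : Set (S → E)}
    (hB : MeasurableSet[cylinderEvents (X := fun _ : S => E) (({t} : Finset S) : Set S)ᶜ] B)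
    {F : Finset S} {f : (S → E) → ℝ} (hf : DependsOn f (F : Set S)) :
    ∫ ω in B, ρ.resample t f ω ∂μ = ∫ ω in B, f ω ∂μ := by
  classical
  have := hμ.1
  have hmle : cylinderEvents (X := fun _ : S => E) (({t} : Finset S) : Set S)ᶜ ≤
      MeasurableSpace.pi := cylinderEvents_le_pi
  have hB' : MeasurableSet B := hmle _ hB
  let g : E → (S → E) → ℝ := fun e => {ζ : S → E | ζ t = e}.indicator fun _ => 1
  -- on `ζ t = e` the function `f` agrees with `f (update · t e)`, which does not involve `t` and
  -- can be pulled out of the conditional expectation of `g e`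
  let h : E → (S → E) → ℝ := fun e => B.indicator fun ω => f (Function.update ω t e)
  have hdep : ∀ e, DependsOn (fun ω : S → E => f (Function.update ω t e))
      ((F.erase t : Finset S) : Set S) := fun e ω τ hωτ => hf fun s hs => by
    by_cases hst : s = t
    · subst hst; simp
    · simp [hst, hωτ s (by simp [hst]; exact hs)]
  have hmeas : ∀ e, StronglyMeasurable[cylinderEvents (X := fun _ : S => E)
      (({t} : Finset S) : Set S)ᶜ] (h e) := fun e =>
    (((measurable_cylinderEvents_of_dependsOn (hdep e)).mono
      (cylinderEvents_mono fun s hs => by simp at hs ⊢; exact hs.2) le_rfl).indicator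
        hB).stronglyMeasurable
  have hsite : ∀ e, MeasurableSet {ζ : S → E | ζ t = e} := fun e =>
    cylinderEvents_le_pi _ (measurableSet_siteEvent t {e})
  have hgint : ∀ e, Integrable (g e) μ := fun e => (integrable_const _).indicator (hsite e)
  have hhint : ∀ e, Integrable (h e) μ := fun e =>
    (integrable_of_dependsOn (hdep e) μ).indicator hB'
  have hghint : ∀ e, Integrable (h e * g e) μ := fun e => by
    have : h e * g e = {ζ : S → E | ζ t = e}.indicator (h e) := by
      funext ω
      by_cases hω : ω t = e <;> simp [g, hω]
    rw [this]
    exact (hhint e).indicator (hsite e)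
  have hpull : ∀ e, (fun ω => h e ω * ρ.siteProb t ω e) =ᵐ[μ]
      μ[h e * g e | cylinderEvents (X := fun _ : S => E) (({t} : Finset S) : Set S)ᶜ] := fun e => by
    have h1 := condExp_mul_of_stronglyMeasurable_left (hmeas e) (hghint e) (hgint e)
    have h2 := hμ.2 {t} {ζ : S → E | ζ t = e} (measurableSet_siteEvent t {e})
    filter_upwards [h1, h2] with ω h1 h2
    rw [h1, Pi.mul_apply, h2]
    rfl
  have hint : ∀ e, Integrable (fun ω => h e ω * ρ.siteProb t ω e) μ := fun e =>
    integrable_condExp.congr (hpull e).symm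
  calc ∫ ω in B, ρ.resample t f ω ∂μ
      = ∫ ω, ∑ e, h e ω * ρ.siteProb t ω e ∂μ := by
        rw [← integral_indicator hB']
        refine integral_congr_ae (.of_forall fun ω => ?_)
        by_cases hω : ω ∈ B
        · simp only [Set.indicator_of_mem hω, Specification.resample, h]
          exact Finset.sum_congr rfl fun e _ => mul_comm _ _
        · simp [hω, h]
    _ = ∑ e, ∫ ω, h e ω * g e ω ∂μ := by
        rw [integral_finsetSum _ fun e _ => hint e]
        refine Finset.sum_congr rfl fun e _ => ?_
        rw [integral_congr_ae (hpull e), integral_condExp hmle]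
        rfl
    _ = ∫ ω in B, f ω ∂μ := by
        rw [← integral_indicator hB', ← integral_finsetSum _ fun e _ =>
          (show Integrable (fun ω => h e ω * g e ω) μ from hghint e)]
        refine integral_congr_ae (.of_forall fun ω => ?_)
        by_cases hω : ω ∈ B <;> simp [hω, h, g, Set.indicator_apply]

lemma isInvariantAt_of_isGibbs (hμ : ρ.IsGibbs μ) (t : S) : ρ.IsInvariantAt t μ :=
  fun _ _ hf => by simpa using setIntegral_resample hμ (t := t) MeasurableSet.univ hf

lemma isInvariantAt_cond (hμ : ρ.IsGibbs μ) {V : Set S} {B : Set (S → E)}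
    (hB : MeasurableSet[cylinderEvents (X := fun _ : S => E) V] B) {t : S} (ht : t ∉ V) :
    ρ.IsInvariantAt t (cond μ B) := fun F f hf => by
  have hB' : MeasurableSet[cylinderEvents (X := fun _ : S => E) (({t} : Finset S) : Set S)ᶜ] B :=
    cylinderEvents_mono (by simpa) _ hB
  rw [ProbabilityTheory.cond, integral_smul_measure, integral_smul_measure,
    setIntegral_resample hμ hB' hf]

omit [MeasurableSpace E] [Fintype E] [MeasurableSingletonClass E] in
lemma osc_indicator_le_one (s : S) (A : Set (S → E)) :
    osc s (A.indicator fun _ => (1 : ℝ)) ≤ 1 := by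
  classical
  refine osc_le fun ω τ _ => ?_
  rw [edist_dist, ← ENNReal.ofReal_one, Real.dist_eq]
  refine ENNReal.ofReal_le_ofReal ?_
  by_cases h1 : ω ∈ A <;> by_cases h2 : τ ∈ A <;> simp [h1, h2]

omit [Fintype E] in
lemma exists_localEvents_symmDiff_lt [Finite E] (μ : Measure (S → E)) [IsFiniteMeasure μ]
    {U : Set S} {A : Set (S → E)}
    (hA : MeasurableSet[cylinderEvents (X := fun _ : S => E) U] A) {ε : ℝ} (hε : 0 < ε) :
    ∃ A' ∈ localEvents E U, MeasurableSet A' ∧ μ (symmDiff A A') < ENNReal.ofReal ε := by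
  have hle : cylinderEvents (X := fun _ : S => E) U ≤ MeasurableSpace.pi := cylinderEvents_le_pi
  have hdense := @Measure.MeasureDense.of_generateFrom_isSetAlgebra_finite (S → E)
    (cylinderEvents U) (μ.trim hle) (localEvents E U) inferInstance
    (isSetAlgebra_localEvents U) (generateFrom_localEvents U)
  obtain ⟨A', hA', hsymm⟩ := @Measure.MeasureDense.approx _ (cylinderEvents U) _ _ hdense A hA
    (by rw [trim_measurableSet_eq hle hA]; exact measure_ne_top _ _) ε hε
  have hA'm := @Measure.MeasureDense.measurable _ (cylinderEvents U) _ _ hdense A' hA'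
  have hsm : MeasurableSet[cylinderEvents (X := fun _ : S => E) U] (symmDiff A A') :=
    @MeasurableSet.symmDiff _ (cylinderEvents U) _ _ hA hA'm
  rw [trim_measurableSet_eq hle hsm] at hsymm
  exact ⟨A', hA', hle _ hA'm, hsymm⟩

/-- Dobrushin's comparison for events: local events approximate those of `F_U` under both
measures, so the comparison of integrals of local functions carries over. -/
lemma edist_measureReal_le [Nonempty E] [IsProbabilityMeasure μ] [IsProbabilityMeasure ν]
    (hconn : G.Connected) (hdeg : BoundedDegree G) (hρ : ρ.IsMarkovian G k)
    (hγ : ρ.dobrushinConstant < 1) {U V : Set S} (hμ : ∀ t ∉ V, ρ.IsInvariantAt t μ)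
    (hν : ∀ t ∉ V, ρ.IsInvariantAt t ν) {A : Set (S → E)}
    (hA : MeasurableSet[cylinderEvents (X := fun _ : S => E) U] A) :
    edist (μ.real A) (ν.real A) ≤
      (1 - ρ.dobrushinConstant)⁻¹ * expSum G (decayRate k ρ.dobrushinConstant) U V := by
  classical
  set K := (1 - ρ.dobrushinConstant)⁻¹
  set r := decayRate k ρ.dobrushinConstant
  have hloc : ∀ A ∈ localEvents E U, edist (μ.real A) (ν.real A) ≤ K * expSum G r U V := by
    rintro A ⟨F, hF, hA⟩
    have hf : DependsOn (A.indicator fun _ => (1 : ℝ)) (F : Set S) := fun ω τ h => by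
      have := hA h
      simp only [Set.indicator_apply, this]
    have hAm : MeasurableSet A :=
      cylinderEvents_le_pi _ (measurableSet_cylinderEvents_of_dependsOn hA)
    have h := edist_integral_le hconn hdeg hρ hγ hμ hν hf
    rw [integral_indicator_const _ hAm, integral_indicator_const _ hAm, smul_eq_mul, mul_one,
      smul_eq_mul, mul_one] at h
    calc edist (μ.real A) (ν.real A)
        ≤ ∑ s ∈ F, K * (∑' v : V, EReal.exp (-(r * (G.dist s v : EReal)))) := by
          refine h.trans (Finset.sum_le_sum fun s _ => ?_)
          exact mul_le_of_le_one_right' (osc_indicator_le_one s A)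
      _ = K * ∑ s ∈ F, ∑' v : V, EReal.exp (-(r * (G.dist s v : EReal))) := by
          rw [Finset.mul_sum]
      _ ≤ K * expSum G r U V := by
          gcongr
          rw [expSum, ← Finset.tsum_subtype]
          exact ENNReal.tsum_mono_subtype
            (fun s => ∑' v : V, EReal.exp (-(r * (G.dist s v : EReal)))) hF
  have hAm : MeasurableSet A := cylinderEvents_le_pi _ hA
  refine ENNReal.le_of_forall_pos_le_add fun ε hε _ => ?_
  obtain ⟨A', hA', hA'm, hsymm⟩ := exists_localEvents_symmDiff_lt (μ + ν) hA
    (ε := ε) (by exact_mod_cast hε)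
  rw [Measure.add_apply] at hsymm
  have happ : ∀ P : Measure (S → E), IsProbabilityMeasure P →
      edist (P.real A) (P.real A') ≤ P (symmDiff A A') := by
    intro P _
    rw [edist_dist, Real.dist_eq, ENNReal.ofReal_le_iff_le_toReal (measure_ne_top _ _)]
    exact abs_measureReal_sub_le_measureReal_symmDiff' hAm.nullMeasurableSet
      hA'm.nullMeasurableSet (measure_ne_top _ _) (measure_ne_top _ _)
  calc edist (μ.real A) (ν.real A)
      ≤ edist (μ.real A) (μ.real A') + edist (μ.real A') (ν.real A') +
          edist (ν.real A') (ν.real A) := edist_triangle4 _ _ _ _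
    _ ≤ μ (symmDiff A A') + K * expSum G r U V + ν (symmDiff A A') := by
        gcongr
        · exact happ μ inferInstance
        · exact hloc A' hA'
        · rw [edist_comm]
          exact happ ν inferInstance
    _ = K * expSum G r U V + (μ (symmDiff A A') + ν (symmDiff A A')) := by ring
    _ ≤ K * expSum G r U V + ε := by
        gcongr
        exact hsymm.le.trans_eq (by simp)

lemma isGibbs_unique [Nonempty E] (hconn : G.Connected) (hdeg : BoundedDegree G)
    (hρ : ρ.IsMarkovian G k) (hγ : ρ.dobrushinConstant < 1) (hμ : ρ.IsGibbs μ)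
    (hν : ρ.IsGibbs ν) : ν = μ := by
  have := hμ.1
  have := hν.1
  ext A hA
  have h := edist_measureReal_le (U := Set.univ) (V := ∅) hconn hdeg hρ hγ
    (fun t _ => isInvariantAt_of_isGibbs hν t) (fun t _ => isInvariantAt_of_isGibbs hμ t)
    (A := A) (by rwa [cylinderEvents_univ])
  have h0 : edist (ν.real A) (μ.real A) = 0 := by simpa [expSum] using h
  exact (measureReal_eq_measureReal_iff).mp (edist_eq_zero.mp h0)

lemma isPhiMixing_of_isGibbs [Nonempty E] (hconn : G.Connected) (hdeg : BoundedDegree G)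
    (hρ : ρ.IsMarkovian G k) (hγ : ρ.dobrushinConstant < 1) (hμ : ρ.IsGibbs μ) :
    IsPhiMixing G μ (decayRate k ρ.dobrushinConstant) := by
  have := hμ.1
  have hK : (1 - ρ.dobrushinConstant)⁻¹ ≠ ⊤ :=
    ENNReal.inv_ne_top.mpr (tsub_pos_of_lt hγ).ne'
  refine ⟨(1 - ρ.dobrushinConstant)⁻¹.toReal, ?_, fun U V _ => ?_⟩
  · rw [← ENNReal.toReal_one, ENNReal.toReal_le_toReal ENNReal.one_ne_top hK,
      ENNReal.one_le_inv]
    exact tsub_le_self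
  · rw [ENNReal.ofReal_toReal hK]
    refine iSup_le fun A => iSup_le fun B => iSup_le fun hA => iSup_le fun hB => iSup_le
      fun hpos => ?_
    have := cond_isProbabilityMeasure hpos.ne'
    rw [← Real.dist_eq, ← edist_dist]
    exact edist_measureReal_le hconn hdeg hρ hγ (fun t ht => isInvariantAt_cond hμ hB ht)
      (fun t _ => isInvariantAt_of_isGibbs hμ t) hA

end Gibbs

/-! ### Existence of a Gibbs measure -/

section Existence

variable {S E : Type*} [Fintype E] [MeasurableSpace E] {ρ : Specification S E}

open Classical in
/-- The law on the whole space of the configuration sampled from `ρ_Λ^ω` in the box `Λ` and equal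
to `ω` off `Λ`. -/
noncomputable def Specification.boxMeasure (ρ : Specification S E) (ω : S → E) (Λ : Finset S) :
    Measure (S → E) :=
  ∑ w : Λ → E, ρ.kernel Λ ω {ζ | Λ.restrict ζ = w} • Measure.dirac (glue Λ w ω)

omit [Fintype E] [MeasurableSpace E] in
lemma glue_empty (w : (∅ : Finset S) → E) (ω : S → E) : glue ∅ w ω = ω := by
  funext s
  simp [glue]

omit [Fintype E] [MeasurableSpace E] in
lemma glue_restrict_of_mem {Λ : Finset S} {s : S} (hs : s ∈ Λ) (ζ ω : S → E) :
    glue Λ (Λ.restrict ζ) ω s = ζ s := by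
  simp [glue, hs]

omit [Fintype E] [MeasurableSpace E] in
lemma glue_of_notMem {Λ : Finset S} {s : S} (hs : s ∉ Λ) (w : Λ → E) (ω : S → E) :
    glue Λ w ω s = ω s := by
  simp [glue, hs]

/-- On events of the box, the box measure is the kernel: this is the consistency of `ρ` for the
empty set of sites. -/
lemma boxMeasure_apply (ρ : Specification S E) (ω : S → E) (Λ : Finset S) {A : Set (S → E)}
    (hA : MeasurableSet[cylinderEvents (X := fun _ : S => E) (Λ : Set S)] A) :
    ρ.boxMeasure ω Λ A = ρ.kernel Λ ω A := by
  classical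
  have := ρ.isMarkovKernel ∅
  rw [ρ.consistent ∅ Λ (Finset.empty_subset _) ω A hA, Specification.boxMeasure,
    Measure.coe_finsetSum, Finset.sum_apply]
  refine Finset.sum_congr (by congr!) fun w _ => ?_
  rw [Measure.smul_apply, smul_eq_mul, Measure.dirac_apply' _ (cylinderEvents_le_pi _ hA)]
  congr 1
  simp_rw [glue_empty]
  by_cases h : glue Λ w ω ∈ A <;> simp [h]

lemma isProbabilityMeasure_boxMeasure (ρ : Specification S E) (ω : S → E) (Λ : Finset S) :
    IsProbabilityMeasure (ρ.boxMeasure ω Λ) := by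
  have := ρ.isMarkovKernel Λ
  exact ⟨by rw [boxMeasure_apply ρ ω Λ MeasurableSet.univ, measure_univ]⟩

variable [MeasurableSingletonClass E]

/-- The box measure of `Λ` has the conditional probabilities required of a Gibbs measure for
events of `Δ ⊆ Λ` and conditions in `Λ \ Δ`. -/
lemma integral_indicator_kernel_boxMeasure [Countable S] {Δ Λ F : Finset S} (ω : S → E)
    (hΔ : Δ ⊆ Λ) (hF : F ⊆ Λ) (hFΔ : (F : Set S) ⊆ (Δ : Set S)ᶜ) {A B : Set (S → E)}
    (hA : MeasurableSet[cylinderEvents (X := fun _ : S => E) (Δ : Set S)] A)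
    (hB : DependsOn (· ∈ B) (F : Set S)) :
    ∫ ξ, B.indicator (fun ξ => (ρ.kernel Δ ξ A).toReal) ξ ∂ρ.boxMeasure ω Λ =
      (ρ.boxMeasure ω Λ).real (A ∩ B) := by
  classical
  have := ρ.isMarkovKernel Λ
  have := ρ.isMarkovKernel Δ
  have hBm : MeasurableSet[cylinderEvents (X := fun _ : S => E) (Λ : Set S)] B :=
    cylinderEvents_mono (by exact_mod_cast hF) _ (measurableSet_cylinderEvents_of_dependsOn hB)
  have hAm : MeasurableSet[cylinderEvents (X := fun _ : S => E) (Λ : Set S)] A :=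
    cylinderEvents_mono (by exact_mod_cast hΔ) _ hA
  have hAB : MeasurableSet[cylinderEvents (X := fun _ : S => E) (Λ : Set S)] (A ∩ B) :=
    @MeasurableSet.inter _ (cylinderEvents (Λ : Set S)) _ _ hAm hBm
  rw [measureReal_def, boxMeasure_apply ρ ω Λ hAB, ρ.consistent Δ Λ hΔ ω _ hAB,
    ENNReal.toReal_sum, Specification.boxMeasure, integral_finsetSum_measure]
  · refine Finset.sum_congr (by congr!) fun w _ => ?_
    rw [integral_smul_measure, integral_dirac, ENNReal.toReal_mul, smul_eq_mul]
    congr 1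
    have hmemA : ∀ ζ ξ : S → E, glue Δ (Δ.restrict ζ) ξ ∈ A ↔ ζ ∈ A := fun ζ ξ =>
      (dependsOn_of_measurableSet hA fun s hs => glue_restrict_of_mem hs ζ ξ).to_iff
    have hmemB : ∀ ζ ξ : S → E, glue Δ (Δ.restrict ζ) ξ ∈ B ↔ ξ ∈ B := fun ζ ξ =>
      (hB fun s hs => glue_of_notMem (hFΔ hs) _ ξ).to_iff
    simp_rw [Set.mem_inter_iff, hmemA, hmemB]
    by_cases h : glue Λ w ω ∈ B <;> simp [h]
  · exact fun w _ => (integrable_dirac (by simp)).smul_measure (measure_ne_top _ _)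
  · exact fun w _ => ENNReal.mul_ne_top (measure_ne_top _ _) (measure_ne_top _ _)

omit [MeasurableSpace E] [MeasurableSingletonClass E] [Fintype E] in
lemma continuous_of_dependsOn [TopologicalSpace E] [DiscreteTopology E]
    {F : Finset S} {f : (S → E) → ℝ} (hf : DependsOn f (F : Set S)) : Continuous f := by
  obtain ⟨g, rfl⟩ := dependsOn_iff_exists_comp.mp hf
  have : Continuous g := continuous_of_discreteTopology
  exact this.comp (continuous_pi fun s => continuous_apply (s : S))

/-- Since the spin space is finite, the configuration space is compact, so any family of
probability measures converges along an ultrafilter. -/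
lemma exists_tendsto_integral [Countable S] {ι : Type*} (l : Ultrafilter ι)
    (P : ι → Measure (S → E)) (hP : ∀ i, IsProbabilityMeasure (P i)) :
    ∃ μ : Measure (S → E), IsProbabilityMeasure μ ∧ ∀ (F : Finset S) (f : (S → E) → ℝ),
      DependsOn f (F : Set S) →
        Filter.Tendsto (fun i => ∫ ω, f ω ∂P i) l (nhds (∫ ω, f ω ∂μ)) := by
  let _ : TopologicalSpace E := ⊥
  have : DiscreteTopology E := ⟨rfl⟩
  let Q : ι → ProbabilityMeasure (S → E) := fun i => ⟨P i, hP i⟩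
  obtain ⟨μ, -, hμ⟩ := isCompact_univ.ultrafilter_le_nhds (l.map Q) (by simp)
  refine ⟨μ, inferInstance, fun F f hf => ?_⟩
  obtain ⟨M, hM⟩ := exists_bound_of_dependsOn hf
  exact ProbabilityMeasure.tendsto_iff_forall_integral_tendsto.mp hμ
    (BoundedContinuousFunction.ofNormedAddCommGroup f (continuous_of_dependsOn hf) M hM)

/-- It suffices to test the Gibbs property on local conditions. -/
lemma isGibbs_of_local {G : SimpleGraph S} {k : ℕ} (hρ : ρ.IsMarkovian G k)
    (hfin : ∀ Λ : Finset S, (boundary G k (Λ : Set S)).Finite) {μ : Measure (S → E)}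
    [IsProbabilityMeasure μ]
    (h : ∀ (Δ : Finset S) (A : Set (S → E)),
      MeasurableSet[cylinderEvents (X := fun _ : S => E) (Δ : Set S)] A →
        ∀ B ∈ localEvents E (Δ : Set S)ᶜ,
          ∫ ξ, B.indicator (fun ξ => (ρ.kernel Δ ξ A).toReal) ξ ∂μ = μ.real (A ∩ B)) :
    ρ.IsGibbs μ := by
  refine ⟨inferInstance, fun Δ A hA => ?_⟩
  have := ρ.isMarkovKernel Δ
  have hle : cylinderEvents (X := fun _ : S => E) (Δ : Set S)ᶜ ≤ MeasurableSpace.pi :=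
    cylinderEvents_le_pi
  have hAm : MeasurableSet A := cylinderEvents_le_pi _ hA
  have hsub : ((hfin Δ).toFinset : Set S) ⊆ (Δ : Set S)ᶜ := fun s hs => by
    rw [Set.Finite.coe_toFinset] at hs
    exact hs.1
  have hdep : DependsOn (fun ξ => ρ.kernel Δ ξ A) ((hfin Δ).toFinset : Set S) :=
    fun ξ η hξη => by
      simp only
      rw [hρ Δ ξ η fun s hs => hξη s (by simpa using hs)]
  have hdep' : DependsOn (fun ξ => (ρ.kernel Δ ξ A).toReal) ((hfin Δ).toFinset : Set S) :=
    fun ξ η hξη => congrArg ENNReal.toReal (hdep hξη)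
  have hint := integrable_of_dependsOn hdep' μ
  have hmeas : Measurable fun ξ => ρ.kernel Δ ξ A := measurable_of_dependsOn hdep
  -- both sides of the identity are finite measures in `B`
  have hlint : ∀ B, MeasurableSet B → ∫⁻ ξ in B, ρ.kernel Δ ξ A ∂μ =
      ENNReal.ofReal (∫ ξ in B, (ρ.kernel Δ ξ A).toReal ∂μ) := fun B hB => by
    rw [integral_toReal hmeas.aemeasurable
      (.of_forall fun ξ => measure_lt_top _ _), ENNReal.ofReal_toReal]
    refine ((setLIntegral_mono measurable_const fun ξ _ =>
      (prob_le_one : ρ.kernel Δ ξ A ≤ 1)).trans_lt ?_).ne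
    simp
  have hloc : ∀ B ∈ localEvents E (Δ : Set S)ᶜ,
      μ.restrict A B = μ.withDensity (fun ξ => ρ.kernel Δ ξ A) B := fun B hB => by
    have hBm : MeasurableSet B := by
      obtain ⟨F, -, hF⟩ := hB
      exact cylinderEvents_le_pi _ (measurableSet_cylinderEvents_of_dependsOn hF)
    rw [withDensity_apply _ hBm, hlint B hBm, ← integral_indicator hBm, h Δ A hA B hB,
      ofReal_measureReal, Measure.restrict_apply hBm, Set.inter_comm]
  have hall : ∀ B, MeasurableSet[cylinderEvents (X := fun _ : S => E) (Δ : Set S)ᶜ] B →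
      μ.restrict A B = μ.withDensity (fun ξ => ρ.kernel Δ ξ A) B := fun B hB =>
    ext_on_measurableSpace_of_generate_finite MeasurableSpace.pi (localEvents E (Δ : Set S)ᶜ)
      hloc hle (generateFrom_localEvents _)
      (fun s hs t ht _ => (isSetAlgebra_localEvents _).inter_mem hs ht)
      (hloc _ (isSetAlgebra_localEvents _).univ_mem) hB
  refine (ae_eq_condExp_of_forall_setIntegral_eq hle ((integrable_const _).indicator hAm)
    (fun _ _ _ => hint.integrableOn) (fun B hB _ => ?_) ?_).symm
  · have hBm : MeasurableSet B := hle _ hB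
    have h1 := hall B hB
    rw [withDensity_apply _ hBm, hlint B hBm, Measure.restrict_apply hBm] at h1
    rw [setIntegral_indicator hAm, setIntegral_const, smul_eq_mul, mul_one, measureReal_def, h1,
      ENNReal.toReal_ofReal (integral_nonneg fun ξ => ENNReal.toReal_nonneg)]
  · exact ((measurable_cylinderEvents_of_dependsOn hdep').mono
      (cylinderEvents_mono hsub) le_rfl).stronglyMeasurable.aestronglyMeasurable

lemma exists_isGibbs [Countable S] [Nonempty E] {G : SimpleGraph S} {k : ℕ}
    (hρ : ρ.IsMarkovian G k)
    (hfin : ∀ Λ : Finset S, (boundary G k (Λ : Set S)).Finite) :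
    ∃ μ : Measure (S → E), ρ.IsGibbs μ := by
  classical
  let ω : S → E := fun _ => Classical.arbitrary E
  let l : Ultrafilter (Finset S) := Ultrafilter.of Filter.atTop
  obtain ⟨μ, hμ, hlim⟩ := exists_tendsto_integral l (ρ.boxMeasure ω)
    (isProbabilityMeasure_boxMeasure ρ ω)
  refine ⟨μ, isGibbs_of_local hρ hfin fun Δ A hA B hB => ?_⟩
  obtain ⟨F, hFΔ, hF⟩ := hB
  have hdepA := dependsOn_of_measurableSet hA
  have hABm : MeasurableSet (A ∩ B) := (cylinderEvents_le_pi _ hA).inter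
    (cylinderEvents_le_pi _ (measurableSet_cylinderEvents_of_dependsOn hF))
  have h1 := hlim (F ∪ (hfin Δ).toFinset) (B.indicator fun ξ => (ρ.kernel Δ ξ A).toReal) <| by
    intro ξ η hξη
    have hB := hF fun s hs => hξη s (by simp at hs ⊢; tauto)
    have hk := hρ Δ ξ η fun s hs => hξη s (by simp; tauto)
    simp only at hB
    simp only [Set.indicator_apply, hB, hk]
  have h2 := hlim (Δ ∪ F) ((A ∩ B).indicator fun _ => 1) <| by
    intro ξ η hξη
    have hA := hdepA fun s hs => hξη s (by simp at hs ⊢; tauto)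
    have hB := hF fun s hs => hξη s (by simp at hs ⊢; tauto)
    simp only at hA hB
    simp only [Set.indicator_apply, Set.mem_inter_iff, hA, hB]
  simp only [integral_indicator_const _ hABm, smul_eq_mul, mul_one] at h2
  refine tendsto_nhds_unique (h1.congr' ?_) h2
  have hev : ∀ᶠ Λ in (l : Filter (Finset S)), Δ ∪ F ⊆ Λ :=
    Ultrafilter.of_le Filter.atTop (Filter.eventually_ge_atTop (Δ ∪ F))
  filter_upwards [hev] with Λ hΛ
  exact integral_indicator_kernel_boxMeasure ω (Finset.union_subset_left hΛ)
    (Finset.union_subset_right hΛ) hFΔ hA hF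

end Existence

lemma growthRate_nonneg {S : Type*} (G : SimpleGraph S) : 0 ≤ growthRate G :=
  Real.sInf_nonneg fun _ h => h.1

end GibbsField

theorem mainTheorem5 {S E : Type*} [Countable S] [Infinite S]
    [Fintype E] [Nonempty E] [MeasurableSpace E] [MeasurableSingletonClass E]
    (G : SimpleGraph S) (hconn : G.Connected) (hdeg : GibbsField.BoundedDegree G)
    (k : ℕ) (ρ : GibbsField.Specification S E) (hρ : ρ.IsMarkovian G k)
    (hγ : ρ.dobrushinConstant <
      ENNReal.ofReal (Real.exp (-(3 * GibbsField.growthRate G * (k : ℝ))))) :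
    ∃ μ : MeasureTheory.Measure (S → E), ρ.IsGibbs μ ∧
      (∀ ν : MeasureTheory.Measure (S → E), ρ.IsGibbs ν → ν = μ) ∧
      GibbsField.IsPhiMixing G μ (GibbsField.decayRate k ρ.dobrushinConstant) := by
  have hγ1 : ρ.dobrushinConstant < 1 := by
    refine hγ.trans_le ?_
    rw [← ENNReal.ofReal_one]
    refine ENNReal.ofReal_le_ofReal (Real.exp_le_one_iff.mpr ?_)
    have := GibbsField.growthRate_nonneg G
    rw [neg_nonpos]
    positivity
  obtain ⟨μ, hμ⟩ := GibbsField.exists_isGibbs hρ fun Λ =>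
    GibbsField.finite_boundary hconn hdeg Λ
  exact ⟨μ, hμ, fun ν hν => GibbsField.isGibbs_unique hconn hdeg hρ hγ1 hμ hν,
    GibbsField.isPhiMixing_of_isGibbs hconn hdeg hρ hγ1 hμ⟩
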